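/- Let $\mathbb{L}^{n+2}=\mathbb{R}\times\mathbb{R}^{n+1}$ carry the Lorentzian product $\langle x,y\rangle=-x_0y_0+\sum_{i=1}^{n+1}x_iy_i$ and let $\mathbb{H}^{n+1}=\{x\in\mathbb{L}^{n+2}:\langle x,x\rangle=-1,\ x_0>0\}$. For an immersed hypersurface $\phi$ in $\mathbb{H}^{n+1}$ oriented by a smooth unit normal $\eta$, put $\psi=\phi+\eta=(\psi_0,\dots,\psi_{n+1})$. The support function of $\phi$ is $e^{\rho}=\psi_0$ and its hyperbolic Gauss map is $G=\frac{1}{\psi_0}(\psi_1,\dots,\psi_{n+1})\in\mathbb{S}^n$, so that $\psi=e^{\rho}(1,G)$; that is, $G(p)$ is the point at infinity of the horosphere $\mathcal{H}_p=\{y\in\mathbb{H}^{n+1}:\langle y,\psi(p)\rangle=-1\}$, which passes through $\phi(p)$ with inner unit normal $\eta(p)$. The hypersurface is horospherically convex at $p$ if a punctured neighbourhood of $p$ in it does not meet $\mathcal{H}_p$ and its distance function to $\mathcal{H}_p$ does not vanish up to second order at $p$ in any direction; it is locally horospherically convex if this holds at every $p$. **Theorem.** Let $U\subset\mathbb{S}^n$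 be open and let $\phi:U\to\mathbb{H}^{n+1}$ be a smooth, immersed, oriented, locally horospherically convex hypersurface with hyperbolic Gauss map $G(x)=x$ and support function $e^{\rho}:U\to(0,\infty)$. Then for every $x\in U$ $$\phi(x)=\frac{e^{\rho}}{2}\Big(1+e^{-2\rho}\big(1+\|\nabla^{g_0}\rho\|_{g_0}^2\big)\Big)(1,x)+e^{-\rho}\,\big(0,-x+\nabla^{g_0}\rho\big),$$ where $\rho$ and $\nabla^{g_0}\rho$ are evaluated at $x$, $g_0$ is the canonical metric of $\mathbb{S}^n$, and the gradient $\nabla^{g_0}\rho\in T_x\mathbb{S}^n$ is regarded as a vector of $\mathbb{R}^{n+1}$ orthogonal to $x$. -/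

import Mathlib

open scoped Manifold ContDiff Topology

noncomputable section

namespace HoroConvex

/-- Euclidean space `ℝⁿ⁺¹`. -/
abbrev Euc (n : ℕ) : Type := EuclideanSpace ℝ (Fin (n + 1))

/-- The unit sphere `𝕊ⁿ ⊂ ℝⁿ⁺¹`. -/
abbrev Sph (n : ℕ) : Type := Metric.sphere (0 : Euc n) 1

/-! ### The Minkowski model -/

/-- The Minkowski space `𝕃ⁿ⁺² = ℝ × ℝⁿ⁺¹`; the first factor is the time coordinate `x₀`. -/
abbrev Mink (n : ℕ) : Type := ℝ × Euc n

/-- The Lorentzian product `-x₀y₀ + x₁y₁ + ⋯ + xₙ₊₁yₙ₊₁`. -/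
def lor {n : ℕ} (x y : Mink n) : ℝ := -(x.1 * y.1) + inner ℝ x.2 y.2

/-- Hyperbolic space `ℍⁿ⁺¹ = {x : ⟨x, x⟩ = -1, x₀ > 0}`. -/
def hyperbolicSpace (n : ℕ) : Set (Mink n) := {x | lor x x = -1 ∧ 0 < x.1}

/-- The hyperbolic distance between two points of `ℍⁿ⁺¹`: `cosh d(y, z) = -⟨y, z⟩`. -/
def hyperbolicDist {n : ℕ} (y z : Mink n) : ℝ := Real.arcosh (-lor y z)

/-- The horosphere of `ℍⁿ⁺¹` determined by a future null vector `v = r (1, x)` with `r > 0` and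
`x ∈ 𝕊ⁿ`: the section of `ℍⁿ⁺¹` by the degenerate hyperplane `⟨y, v⟩ = -1`. Its point at infinity
is `x`, and its inner unit normal at `y` is `v - y`. -/
def horosphere {n : ℕ} (v : Mink n) : Set (Mink n) := {y | y ∈ hyperbolicSpace n ∧ lor y v = -1}

/-- The hyperbolic distance of a point `y` to a horosphere. -/
def distToHorosphere {n : ℕ} (v y : Mink n) : ℝ := sInf (hyperbolicDist y '' horosphere v)

/-! ### Oriented hypersurfaces -/

section Hypersurface

variable {n : ℕ} {M : Type*} [TopologicalSpace M] [ChartedSpace (EuclideanSpace ℝ (Fin n)) M]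

/-- `φ : U → ℍⁿ⁺¹` is a smooth immersed hypersurface, defined on an open set `U` of an
`n`-dimensional manifold `M`, and oriented by the smooth unit normal field `η` (a unit vector
field along `φ`, tangent to `ℍⁿ⁺¹`, and normal to `φ`). -/
structure IsOrientedHypersurface (U : Set M) (φ η : M → Mink n) : Prop where
  isOpen : IsOpen U
  smooth : ContMDiffOn (𝓡 n) 𝓘(ℝ, Mink n) ∞ φ U
  mem_hyperbolicSpace : ∀ p ∈ U, φ p ∈ hyperbolicSpace n
  immersion : ∀ p ∈ U, Function.Injective (mvfderiv (𝓡 n) φ p)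
  smooth_normal : ContMDiffOn (𝓡 n) 𝓘(ℝ, Mink n) ∞ η U
  unit_normal : ∀ p ∈ U, lor (η p) (η p) = 1
  normal_tangent : ∀ p ∈ U, lor (η p) (φ p) = 0
  normal_orthogonal : ∀ p ∈ U, ∀ w : TangentSpace (𝓡 n) p, lor (η p) (mvfderiv (𝓡 n) φ p w) = 0

/-- The light cone map `ψ = φ + η`. The horosphere determined by `ψ p` is the one which passes
through `φ p` with inner unit normal `η p`. -/
def lightConeMap (φ η : M → Mink n) (p : M) : Mink n := φ p + η p

/-- The horospherical support function `e^ρ = ψ₀`. -/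
def supportFunction (φ η : M → Mink n) (p : M) : ℝ := (lightConeMap φ η p).1

/-- The hyperbolic Gauss map `G = (ψ₁, …, ψₙ₊₁) / ψ₀`, so that `ψ = e^ρ (1, G)`. This is the point
at infinity of the horosphere through `φ p` with inner unit normal `η p`. -/
def gaussMap (φ η : M → Mink n) (p : M) : Euc n :=
  (supportFunction φ η p)⁻¹ • (lightConeMap φ η p).2

/-- Horospherical convexity at `p`. Let `ℋ` be the horosphere tangent to the hypersurface at `p`,
with the same unit normal there. A punctured neighbourhood of `p` in the hypersurface does not meet
`ℋ`, and the distance to `ℋ` does not vanish up to second order at `p` in any direction: along no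
smooth curve of the hypersurface that starts at `p` with nonzero velocity is it `o(t²)`. -/
def IsHorosphericallyConvexAt (φ η : M → Mink n) (p : M) : Prop :=
  (∃ V ∈ 𝓝 p, ∀ q ∈ V, q ≠ p → φ q ∉ horosphere (lightConeMap φ η p)) ∧
  ∀ γ : ℝ → M, ContMDiffAt 𝓘(ℝ, ℝ) (𝓡 n) ∞ γ 0 → γ 0 = p →
    mfderiv 𝓘(ℝ, ℝ) (𝓡 n) γ 0 ≠ 0 →
    ¬ (fun t => distToHorosphere (lightConeMap φ η p) (φ (γ t))) =o[𝓝 0] (fun t : ℝ => t ^ 2)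

end Hypersurface

/-! ### The gradient on the round sphere -/

/-- The differential at `x` of the inclusion `𝕊ⁿ → ℝⁿ⁺¹`. It identifies `T_x 𝕊ⁿ` with the
orthogonal complement of `x` in `ℝⁿ⁺¹`. -/
def dIncl {n : ℕ} (x : Sph n) : TangentSpace (𝓡 n) x →L[ℝ] Euc n :=
  mvfderiv (𝓡 n) ((↑) : Sph n → Euc n) x

/-- The canonical metric `g₀` of `𝕊ⁿ`, induced by the inclusion in `ℝⁿ⁺¹`. -/
def roundMetric {n : ℕ} (x : Sph n) (u w : TangentSpace (𝓡 n) x) : ℝ :=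
  inner ℝ (dIncl x u) (dIncl x w)

theorem dIncl_injective {n : ℕ} (x : Sph n) : Function.Injective (dIncl x) := by
  have := Fact.mk (@finrank_euclideanSpace_fin ℝ _ (n + 1))
  exact injective_mvfderiv_subtypeVal_sphere (E := Euc n) x

theorem exists_gradient {n : ℕ} (ρ : Sph n → ℝ) (x : Sph n) :
    ∃ u : TangentSpace (𝓡 n) x, ∀ w, roundMetric x u w = mvfderiv (𝓡 n) ρ x w := by
  have : FiniteDimensional ℝ (TangentSpace (𝓡 n) x) :=
    inferInstanceAs (FiniteDimensional ℝ (EuclideanSpace ℝ (Fin n)))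
  let A : TangentSpace (𝓡 n) x →ₗ[ℝ] Euc n := (dIncl x).toLinearMap
  let B : TangentSpace (𝓡 n) x →ₗ[ℝ] Module.Dual ℝ (TangentSpace (𝓡 n) x) :=
    (innerₗ (Euc n)).compl₁₂ A A
  have hB : ∀ u w, B u w = roundMetric x u w := fun u w => rfl
  have hinj : Function.Injective B := by
    rw [injective_iff_map_eq_zero]
    intro u hu
    have h : roundMetric x u u = 0 := by rw [← hB, hu]; rfl
    have h0 : dIncl x u = 0 := inner_self_eq_zero.mp h
    exact dIncl_injective x (h0.trans (map_zero (dIncl x)).symm)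
  have hsurj : Function.Surjective B :=
    (LinearMap.injective_iff_surjective_of_finrank_eq_finrank
      (Subspace.dual_finrank_eq (K := ℝ) (V := TangentSpace (𝓡 n) x)).symm).mp hinj
  obtain ⟨u, hu⟩ := hsurj (mvfderiv (𝓡 n) ρ x).toLinearMap
  exact ⟨u, fun w => by rw [← hB, hu]; rfl⟩

/-- The Riemannian gradient of `ρ` for `g₀`: the tangent vector `u` at `x` with
`g₀(u, w) = dρ(w)` for all tangent vectors `w`. -/
def tangentGradient {n : ℕ} (ρ : Sph n → ℝ) (x : Sph n) : TangentSpace (𝓡 n) x :=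
  (exists_gradient ρ x).choose

theorem roundMetric_tangentGradient {n : ℕ} (ρ : Sph n → ℝ) (x : Sph n)
    (w : TangentSpace (𝓡 n) x) :
    roundMetric x (tangentGradient ρ x) w = mvfderiv (𝓡 n) ρ x w :=
  (exists_gradient ρ x).choose_spec w

/-- The gradient of `ρ` for `g₀`, regarded as a vector of `ℝⁿ⁺¹` orthogonal to `x`. Its Euclidean
norm is the `g₀`-norm of the gradient. -/
def sphereGradient {n : ℕ} (ρ : Sph n → ℝ) (x : Sph n) : Euc n :=
  dIncl x (tangentGradient ρ x)

end HoroConvex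

end

open HoroConvex

namespace HoroConvex

/-! ### Chain and Leibniz rules for vector-valued functions on a manifold. -/

section Calculus

variable {H K M : Type*} [NormedAddCommGroup K] [NormedSpace ℝ K] [TopologicalSpace H]
  {I : ModelWithCorners ℝ K H} [TopologicalSpace M] [ChartedSpace H M]
  {E F G : Type*} [NormedAddCommGroup E] [NormedSpace ℝ E] [NormedAddCommGroup F]
  [NormedSpace ℝ F] [NormedAddCommGroup G] [NormedSpace ℝ G]

/-! Since `ψ = φ + η = e^ρ (1, x)` and `⟨φ, ψ⟩ = -1`, one has `⟨φ, (1, x)⟩ = -e^{-ρ}` (`lor_null`).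
Differentiate this in `x`: as `dφ` is orthogonal to `ψ`, only `⟨φ, (0, w)⟩ = e^{-ρ} dρ(w)` survives
(`inner_dIncl`), so the part of the spatial component of `φ` tangent to the sphere is `e^{-ρ} ∇ρ`
(`exp_smul_tangential`). Two unknowns remain, the time coordinate and the component along `x`;
`lor_null` gives their difference, and `⟨φ, φ⟩ = -1` then fixes both. -/

theorem mdifferentiableAt_comp_hasFDerivAt {f : M → E} {g : E → F} {g' : E →L[ℝ] F} {x : M}
    (hg : HasFDerivAt g g' (f x)) (hf : MDifferentiableAt I 𝓘(ℝ, E) f x) :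
    MDifferentiableAt I 𝓘(ℝ, F) (fun y => g (f y)) x :=
  hg.differentiableAt.mdifferentiableAt.comp x hf

/-- Chain rule for a map between vector spaces after a vector-valued function. -/
theorem mvfderiv_comp_hasFDerivAt {f : M → E} {g : E → F} {g' : E →L[ℝ] F} {x : M}
    (hg : HasFDerivAt g g' (f x)) (hf : MDifferentiableAt I 𝓘(ℝ, E) f x) (w : TangentSpace I x) :
    mvfderiv I (fun y => g (f y)) x w = g' (mvfderiv I f x w) := by
  have h := (hg.hasMFDerivAt.comp x hf.hasMFDerivAt).mfderiv
  exact congrArg (fun L => L w) h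

theorem mvfderiv_prodMk {f : M → E} {g : M → F} {x : M}
    (hf : MDifferentiableAt I 𝓘(ℝ, E) f x) (hg : MDifferentiableAt I 𝓘(ℝ, F) g x)
    (w : TangentSpace I x) :
    mvfderiv I (fun y => (f y, g y)) x w = (mvfderiv I f x w, mvfderiv I g x w) := by
  have h := hf.prodMk_space hg
  ext1
  · exact (mvfderiv_comp_hasFDerivAt (g := Prod.fst) hasFDerivAt_fst h w).symm
  · exact (mvfderiv_comp_hasFDerivAt (g := Prod.snd) hasFDerivAt_snd h w).symm

/-- Leibniz rule for a continuous bilinear map. -/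
theorem mvfderiv_bilinear (B : E →L[ℝ] F →L[ℝ] G) {f : M → E} {g : M → F} {x : M}
    (hf : MDifferentiableAt I 𝓘(ℝ, E) f x) (hg : MDifferentiableAt I 𝓘(ℝ, F) g x)
    (w : TangentSpace I x) :
    mvfderiv I (fun y => B (f y) (g y)) x w =
      B (f x) (mvfderiv I g x w) + B (mvfderiv I f x w) (g x) := by
  have h := mvfderiv_comp_hasFDerivAt (f := fun y => (f y, g y)) (g := fun p : E × F => B p.1 p.2)
    (B.isBoundedBilinearMap.hasFDerivAt (f x, g x)) (hf.prodMk_space hg) w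
  rw [h, mvfderiv_prodMk hf hg w]
  simp

theorem mvfderiv_congr {f g : M → E} {x : M} (h : f =ᶠ[𝓝 x] g) :
    mvfderiv I f x = mvfderiv I g x := by
  ext w
  exact congrArg (fun L : K →L[ℝ] E => L w) (h.mfderiv_eq (I := I) (I' := 𝓘(ℝ, E)))

end Calculus

/-- The Lorentzian product as a continuous bilinear map. -/
noncomputable def lorL (n : ℕ) : Mink n →L[ℝ] Mink n →L[ℝ] ℝ :=
  -(ContinuousLinearMap.mul ℝ ℝ).bilinearComp (.fst ℝ ℝ (Euc n)) (.fst ℝ ℝ (Euc n)) +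
    ((isBoundedBilinearMap_inner (𝕜 := ℝ) (E := Euc n)).toContinuousLinearMap).bilinearComp
      (.snd ℝ ℝ (Euc n)) (.snd ℝ ℝ (Euc n))

theorem lorL_apply {n : ℕ} (x y : Mink n) : lorL n x y = lor x y := rfl

theorem lor_comm {n : ℕ} (x y : Mink n) : lor x y = lor y x := by
  simp only [lor, real_inner_comm, mul_comm]

theorem lor_add_right {n : ℕ} (x y z : Mink n) : lor x (y + z) = lor x y + lor x z := by
  simp only [← lorL_apply, map_add]

theorem lor_smul_right {n : ℕ} (x y : Mink n) (c : ℝ) : lor x (c • y) = c * lor x y := by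
  simp only [← lorL_apply, map_smul, smul_eq_mul]

/-- The range of the differential of the inclusion is the orthogonal complement of the position
vector. -/
theorem mem_range_dIncl {n : ℕ} (x : Sph n) {v : Euc n} :
    (∃ u, dIncl x u = v) ↔ inner ℝ (x : Euc n) v = 0 := by
  have := Fact.mk (@finrank_euclideanSpace_fin ℝ _ (n + 1))
  have h := range_mvfderiv_subtypeVal (E := Euc n) (n := n) x
  rw [← Submodule.mem_orthogonal_singleton_iff_inner_right, ← h]
  rfl

theorem inner_sphereGradient {n : ℕ} (ρ : Sph n → ℝ) (x : Sph n) (w : TangentSpace (𝓡 n) x) :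
    inner ℝ (sphereGradient ρ x) (dIncl x w) = mvfderiv (𝓡 n) ρ x w :=
  roundMetric_tangentGradient ρ x w

theorem inner_self_sphereGradient {n : ℕ} (ρ : Sph n → ℝ) (x : Sph n) :
    inner ℝ (x : Euc n) (sphereGradient ρ x) = 0 :=
  (mem_range_dIncl x).1 ⟨_, rfl⟩

/-- A vector orthogonal to `x` that represents `dρ` is the gradient of `ρ`. -/
theorem eq_sphereGradient {n : ℕ} {ρ : Sph n → ℝ} {x : Sph n} {v : Euc n}
    (hv : inner ℝ (x : Euc n) v = 0)
    (h : ∀ w, inner ℝ v (dIncl x w) = mvfderiv (𝓡 n) ρ x w) : v = sphereGradient ρ x := by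
  -- The difference is itself tangent, so it may be tested against itself.
  obtain ⟨u, hu⟩ := (mem_range_dIncl x (v := v - sphereGradient ρ x)).2 (by
    rw [inner_sub_right, hv, inner_self_sphereGradient, sub_zero])
  rw [← sub_eq_zero, ← inner_self_eq_zero (𝕜 := ℝ)]
  nth_rw 2 [← hu]
  rw [inner_sub_left, h, inner_sphereGradient, sub_self]

/-! ### Products of `φ` and `dφ` with the light cone map. -/

section Hypersurface

variable {n : ℕ} {U : Set (Sph n)} {φ η : Sph n → Mink n} {ρ : Sph n → ℝ}

theorem lightConeMap_eq {x : Sph n} (hG : gaussMap φ η x = (x : Euc n))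
    (hρ : Real.exp (ρ x) = supportFunction φ η x) :
    lightConeMap φ η x = Real.exp (ρ x) • ((1 : ℝ), (x : Euc n)) := by
  have h0 : supportFunction φ η x ≠ 0 := hρ ▸ (Real.exp_pos _).ne'
  rw [hρ, ← hG, gaussMap]
  ext1
  · simp [supportFunction]
  · simp [smul_smul, mul_inv_cancel₀ h0]

theorem IsOrientedHypersurface.mdifferentiableAt (hφ : IsOrientedHypersurface U φ η) {x : Sph n}
    (hx : x ∈ U) : MDifferentiableAt (𝓡 n) 𝓘(ℝ, Mink n) φ x :=
  ((hφ.smooth x hx).contMDiffAt (hφ.isOpen.mem_nhds hx)).mdifferentiableAt (by simp)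

theorem IsOrientedHypersurface.mdifferentiableAt_normal (hφ : IsOrientedHypersurface U φ η)
    {x : Sph n} (hx : x ∈ U) : MDifferentiableAt (𝓡 n) 𝓘(ℝ, Mink n) η x :=
  ((hφ.smooth_normal x hx).contMDiffAt (hφ.isOpen.mem_nhds hx)).mdifferentiableAt (by simp)

/-- No regularity of `ρ` is assumed: it comes from `ρ = log ψ₀` on the open set `U`. -/
theorem IsOrientedHypersurface.mdifferentiableAt_log_support (hφ : IsOrientedHypersurface U φ η)
    (hρ : ∀ x ∈ U, Real.exp (ρ x) = supportFunction φ η x) {x : Sph n} (hx : x ∈ U) :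
    MDifferentiableAt (𝓡 n) 𝓘(ℝ, ℝ) ρ x := by
  have h1 : MDifferentiableAt (𝓡 n) 𝓘(ℝ, Mink n) (fun y => φ y + η y) x :=
    (hφ.mdifferentiableAt hx).add (hφ.mdifferentiableAt_normal hx)
  have h0 : (φ x + η x).1 ≠ 0 := (hρ x hx).symm.trans_ne (Real.exp_pos _).ne'
  have h2 := mdifferentiableAt_comp_hasFDerivAt (f := fun y => φ y + η y)
    (g := fun p : Mink n => Real.log p.1)
    ((hasFDerivAt_fst (𝕜 := ℝ) (p := φ x + η x)).log h0) h1
  refine h2.congr_of_eventuallyEq ?_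
  filter_upwards [hφ.isOpen.mem_nhds hx] with y hy
  exact (Real.log_exp _).symm.trans (congrArg Real.log (hρ y hy))

theorem IsOrientedHypersurface.lor_lightConeMap (hφ : IsOrientedHypersurface U φ η) {x : Sph n}
    (hx : x ∈ U) : lor (φ x) (lightConeMap φ η x) = -1 := by
  rw [lightConeMap, lor_add_right, (hφ.mem_hyperbolicSpace x hx).1, lor_comm, hφ.normal_tangent x hx,
    add_zero]

/-- Differentiating `⟨φ, φ⟩ = -1` gives orthogonality of `dφ` to `φ`; orthogonality to `η` is the
normal condition. -/
theorem IsOrientedHypersurface.lor_mvfderiv_lightConeMap (hφ : IsOrientedHypersurface U φ η)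
    {x : Sph n} (hx : x ∈ U) (w : TangentSpace (𝓡 n) x) :
    lor (mvfderiv (𝓡 n) φ x w) (lightConeMap φ η x) = 0 := by
  have h := mvfderiv_bilinear (lorL n) (hφ.mdifferentiableAt hx) (hφ.mdifferentiableAt hx) w
  have hc : (fun y => lorL n (φ y) (φ y)) =ᶠ[𝓝 x] fun _ => (-1 : ℝ) := by
    filter_upwards [hφ.isOpen.mem_nhds hx] with y hy
    exact (hφ.mem_hyperbolicSpace y hy).1
  rw [mvfderiv_congr hc, mvfderiv_const, lorL_apply, lorL_apply, lor_comm (φ x)] at h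
  have h' : lor (mvfderiv (𝓡 n) φ x w) (φ x) = 0 := by
    simp only [_root_.zero_apply] at h
    linarith
  rw [lightConeMap, lor_add_right, h', lor_comm, hφ.normal_orthogonal x hx, add_zero]

theorem IsOrientedHypersurface.lor_null (hφ : IsOrientedHypersurface U φ η)
    (hG : ∀ x ∈ U, gaussMap φ η x = (x : Euc n))
    (hρ : ∀ x ∈ U, Real.exp (ρ x) = supportFunction φ η x) {x : Sph n} (hx : x ∈ U) :
    lor (φ x) ((1 : ℝ), (x : Euc n)) = -Real.exp (-ρ x) := by
  have h := hφ.lor_lightConeMap hx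
  rw [lightConeMap_eq (hG x hx) (hρ x hx), lor_smul_right] at h
  rw [Real.exp_neg]
  field_simp
  linarith

/-- The spatial part of `φ` represents `e^{-ρ} dρ` on the tangent space of the sphere. -/
theorem IsOrientedHypersurface.inner_dIncl (hφ : IsOrientedHypersurface U φ η)
    (hG : ∀ x ∈ U, gaussMap φ η x = (x : Euc n))
    (hρ : ∀ x ∈ U, Real.exp (ρ x) = supportFunction φ η x) {x : Sph n} (hx : x ∈ U)
    (w : TangentSpace (𝓡 n) x) :
    inner ℝ (φ x).2 (dIncl x w) = Real.exp (-ρ x) * mvfderiv (𝓡 n) ρ x w := by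
  have := Fact.mk (@finrank_euclideanSpace_fin ℝ _ (n + 1))
  have hi : MDifferentiableAt (𝓡 n) 𝓘(ℝ, Euc n) ((↑) : Sph n → Euc n) x :=
    (contMDiff_coe_sphere (m := 1) x).mdifferentiableAt one_ne_zero
  have hs : HasFDerivAt (fun z : Euc n => ((1 : ℝ), z)) (.inr ℝ ℝ (Euc n)) (x : Euc n) :=
    hasFDerivAt_prodMk_right 1 _
  have hl := mvfderiv_bilinear (lorL n) (hφ.mdifferentiableAt hx)
    (mdifferentiableAt_comp_hasFDerivAt hs hi) w
  have he : HasFDerivAt (fun t : ℝ => -Real.exp (-t)) _ (ρ x) :=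
    ((Real.hasDerivAt_exp _).comp (ρ x) (hasDerivAt_neg (ρ x))).neg.hasFDerivAt
  have hr := mvfderiv_comp_hasFDerivAt he (hφ.mdifferentiableAt_log_support hρ hx) w
  have hc : (fun y : Sph n => lorL n (φ y) ((1 : ℝ), (y : Euc n))) =ᶠ[𝓝 x]
      fun y => -Real.exp (-ρ y) := by
    filter_upwards [hφ.isOpen.mem_nhds hx] with y hy
    exact hφ.lor_null hG hρ hy
  -- This removes the Leibniz term containing `dφ`, since `(1, x)` is a positive multiple of `ψ`.
  have hd : lor (mvfderiv (𝓡 n) φ x w) ((1 : ℝ), (x : Euc n)) = 0 := by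
    have h := hφ.lor_mvfderiv_lightConeMap hx w
    rw [lightConeMap_eq (hG x hx) (hρ x hx), lor_smul_right] at h
    exact (mul_eq_zero.1 h).resolve_left (Real.exp_pos _).ne'
  rw [mvfderiv_congr hc, hr, mvfderiv_comp_hasFDerivAt hs hi w, lorL_apply, lorL_apply, hd] at hl
  simp [lor] at hl
  rw [dIncl, ← hl, mul_comm]

theorem IsOrientedHypersurface.exp_smul_tangential (hφ : IsOrientedHypersurface U φ η)
    (hG : ∀ x ∈ U, gaussMap φ η x = (x : Euc n))
    (hρ : ∀ x ∈ U, Real.exp (ρ x) = supportFunction φ η x) {x : Sph n} (hx : x ∈ U) :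
    Real.exp (ρ x) • ((φ x).2 - inner ℝ (φ x).2 (x : Euc n) • (x : Euc n)) =
      sphereGradient ρ x := by
  have hxx : inner ℝ (x : Euc n) (x : Euc n) = 1 := by simp
  refine eq_sphereGradient ?_ fun w => ?_
  · rw [inner_smul_right, inner_sub_right, inner_smul_right, hxx, real_inner_comm]
    ring
  · rw [real_inner_smul_left, inner_sub_left, real_inner_smul_left,
      (mem_range_dIncl x).1 ⟨w, rfl⟩, hφ.inner_dIncl hG hρ hx, mul_zero, sub_zero, ← mul_assoc,
      ← Real.exp_add, add_neg_cancel, Real.exp_zero, one_mul]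

end Hypersurface

end HoroConvex

open HoroConvex
theorem mainTheorem2 (n : ℕ) (U : Set (Sph n)) (φ η : Sph n → Mink n) (ρ : Sph n → ℝ)
    (hφ : IsOrientedHypersurface U φ η)
    (hconv : ∀ x ∈ U, IsHorosphericallyConvexAt φ η x)
    (hG : ∀ x ∈ U, gaussMap φ η x = (x : Euc n))
    (hρ : ∀ x ∈ U, Real.exp (ρ x) = supportFunction φ η x) :
    ∀ x ∈ U,
      φ x = (Real.exp (ρ x) / 2 *
              (1 + Real.exp (-2 * ρ x) * (1 + ‖sphereGradient ρ x‖ ^ 2))) • ((1 : ℝ), (x : Euc n))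
            + Real.exp (-ρ x) • ((0 : ℝ), -(x : Euc n) + sphereGradient ρ x) := by
  intro x hx
  have ht := hφ.exp_smul_tangential hG hρ hx
  have hn := hφ.lor_null hG hρ hx
  have hh := (hφ.mem_hyperbolicSpace x hx).1
  have hg := inner_self_sphereGradient ρ x
  have hxx : inner ℝ (x : Euc n) (x : Euc n) = 1 := by simp
  generalize sphereGradient ρ x = v at ht hg ⊢
  have e2 : Real.exp (-2 * ρ x) = Real.exp (-ρ x) ^ 2 := by
    rw [← Real.exp_nat_mul]; congr 1; push_cast; ring
  have e1 : Real.exp (-ρ x) * Real.exp (ρ x) = 1 := by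
    rw [← Real.exp_add, neg_add_cancel, Real.exp_zero]
  rw [e2]
  generalize Real.exp (-ρ x) = r at *
  generalize Real.exp (ρ x) = e at *
  generalize φ x = p at *
  obtain ⟨a, A⟩ := p
  simp only [lor, mul_one] at ht hn hh
  generalize inner ℝ A (x : Euc n) = s at *
  -- Splitting into radial and tangential parts, with `r = e^{-ρ}` and `v = ∇ρ`.
  have hA : A = s • (x : Euc n) + r • v := by
    rw [← ht, smul_smul, e1, one_smul, add_sub_cancel]
  have hAA : inner ℝ A A = s ^ 2 + r ^ 2 * ‖v‖ ^ 2 := by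
    rw [hA, inner_add_left, inner_add_right, inner_add_right]
    simp only [real_inner_smul_left, inner_smul_right, hxx, hg,
      (real_inner_comm _ _).trans hg, real_inner_self_eq_norm_sq v]
    simp
    ring
  rw [hAA] at hh
  have hs : s = a - r := by linarith
  subst hs
  -- With `s = a - r` the terms in `a²` cancel, leaving `2ar = 1 + r²(1 + ‖v‖²)`; multiply by `e /
  -- 2` and use `re = 1`.
  have ha : a = e / 2 * (1 + r ^ 2 * (1 + ‖v‖ ^ 2)) := by
    linear_combination -(e / 2) * hh - a * e1
  rw [← ha, hA]
  ext1
  · simp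
  · simp only [Prod.snd_add, Prod.smul_snd]
    module
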